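/- Let $G$ be a finite undirected multigraph with $n\ge 2$ vertices, $\log=\log_2$. A cut of $G$ is the set of edges joining the two sides of a partition of $V(G)$ into two nonempty parts; $\mathcal C(G)$ is the family of cuts (as edge sets) and $\lambda$ the minimum size of a cut. Put $$z_G(p)=\sum_{C\in\mathcal C(G)}p^{|C|},\qquad x_G(p)=\sum_{C,D\in\mathcal C(G),\,C\ne D}p^{|C\cup D|}\quad(\text{ordered pairs}),$$ and let the phase-transition threshold $\theta=\theta(G)$ be the largest $t\in[0,1]$ such that $x_G(p)/z_G(p)\le 1/\log n$ for all $0<p<t$. A Gomory–Hu tree of $G$ is a weighted tree $Y$ on the vertex set of $G$ such that for all vertices $s\neq t$, a minimum $(s,t)$-cut in $Y$ is also a minimum $(s,t)$-cut in $G$ and has the same value. Let $Y$ be a Gomory–Hu tree of $G$, let $k\le n-1$ be $2^{-2/3}n$ rounded down or up to an integer, let $S_k$ be the sum of the $k$ smallest edge weights of $Y$, and let $\gamma=\min\{\lambda,\tfrac34\cdot\tfrac{S_k}{k}\}$. For $q\in(0,1)$ let $H\sim G(q)$ be the random multigraph obtained from $G$ by contracting each edge independently with probability $1-q$. **Lemma.**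 There is an absolute constant $K$ such that for all such $G$, $Y$, $k$ and all $p\ge 0$, $q>0$: if $q^\gamma=\tfrac12$, $4n^{-3}\le p^\lambda\le n^{-1/2}$ and $p<\theta$, then $\mathbb E[z_H(p/q)]>0$ and the relative second moment of $z_H(p/q)$ is at most $2+O(1/\log n)$: $$\frac{\mathbb E[z_H(p/q)^2]}{(\mathbb E[z_H(p/q)])^2}\le 2+\frac{K}{\log n}.$$ -/

import Mathlib

open scoped Graph

namespace Unreliability

open Classical

noncomputable section

universe u v

variable {α : Type u} {β : Type v} [Fintype β]

/-- The set of edges of the multigraph `G` with exactly one end in `U` (for `U ⊆ V(G)`). -/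
def cutEdges (G : Graph α β) (U : Set α) : Finset β :=
  Finset.univ.filter fun e => ∃ x y, G.IsLink e x y ∧ x ∈ U ∧ y ∉ U

/-- The family of cuts of `G`, each represented by its set of cut edges: one cut for every
partition of the vertex set into two nonempty parts. -/
def cuts (G : Graph α β) : Finset (Finset β) :=
  Finset.univ.filter fun C => ∃ U : Set α, U ⊆ V(G) ∧ U.Nonempty ∧ U ≠ V(G) ∧ C = cutEdges G U

/-- The value `λ` of a minimum cut of `G`. -/
def minCut (G : Graph α β) : ℕ := sInf {c | ∃ C ∈ cuts G, C.card = c}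

/-- `z_G(p)`: the expected number of failed cuts when each edge fails with probability `p`. -/
def zCut (G : Graph α β) (p : ℝ) : ℝ := ∑ C ∈ cuts G, p ^ C.card

/-- `x_G(p)`: the expected number of failed pairs `(C, D)` of distinct cuts. -/
def xCut (G : Graph α β) (p : ℝ) : ℝ :=
  ∑ P ∈ (cuts G).offDiag, p ^ (P.1 ∪ P.2).card

/-- The phase-transition threshold `θ` of `G`: the largest `t ∈ [0, 1]` such that
`x_G(p) / z_G(p) ≤ 1 / log₂ n` for every `0 < p < t`. -/
def theta (G : Graph α β) : ℝ :=
  sSup {t : ℝ | 0 ≤ t ∧ t ≤ 1 ∧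
    ∀ p : ℝ, 0 < p → p < t → xCut G p / zCut G p ≤ 1 / Real.logb 2 (V(G).ncard : ℝ)}

/-- `U` is a minimum `(s, t)`-cut with respect to the function `val` giving the value of the
cut defined by a vertex set. -/
def IsMinSTCut {W : Type u} (val : Set W → ℕ) (s t : W) (U : Set W) : Prop :=
  s ∈ U ∧ t ∉ U ∧ ∀ U' : Set W, s ∈ U' → t ∉ U' → val U ≤ val U'

/-- The value in `G` of the cut defined by a set `U` of vertices of `G`. -/
def cutValue (G : Graph α β) (U : Set V(G)) : ℕ := (cutEdges G (Subtype.val '' U)).card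

/-- The value of the cut defined by `U` in the simple graph `Y` with edge weights `w`. -/
def weightedCutValue {W : Type u} [Fintype W] (Y : SimpleGraph W) (w : Sym2 W → ℕ)
    (U : Set W) : ℕ :=
  ∑ e ∈ Y.edgeFinset.filter (fun e => ∃ x y, e = s(x, y) ∧ x ∈ U ∧ y ∉ U), w e

/-- `(Y, w)` is a Gomory–Hu tree of `G`: a weighted tree on the vertex set of `G` such that, for
all distinct vertices `s, t`, a minimum `(s, t)`-cut in `Y` is also a minimum `(s, t)`-cut
in `G`, and has the same value. -/
def IsGomoryHuTree [Fintype α] (G : Graph α β) (Y : SimpleGraph V(G)) (w : Sym2 V(G) → ℕ) :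
    Prop :=
  Y.IsTree ∧ ∀ s t : V(G), s ≠ t → ∀ U : Set V(G),
    IsMinSTCut (weightedCutValue Y w) s t U →
      IsMinSTCut (cutValue G) s t U ∧ cutValue G U = weightedCutValue Y w U

/-- `S_k`: the sum of the `k` smallest edge weights (with multiplicity) of `(Y, w)`. -/
def sumSmallest {W : Type u} [Fintype W] (Y : SimpleGraph W) (w : Sym2 W → ℕ) (k : ℕ) : ℕ :=
  (((Y.edgeFinset.val.map w).sort (· ≤ ·)).take k).sum

/-- `γ = min {λ, (3/4) · S_k / k}`. -/
def gammaParam [Fintype α] (G : Graph α β) (Y : SimpleGraph V(G)) (w : Sym2 V(G) → ℕ)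
    (k : ℕ) : ℝ :=
  min (minCut G : ℝ) (3 / 4 * ((sumSmallest Y w k : ℝ) / (k : ℝ)))

/-- The multigraph obtained from `G` by contracting the edges in `S`: these edges are removed and
the vertices that they connect are identified. (An uncontracted edge whose ends get identified
stays as a loop; loops lie in no cut.) -/
def contract (G : Graph α β) (S : Finset β) :
    Graph (Quot fun x y : α => ∃ e ∈ S, G.IsLink e x y) β :=
  (G.deleteEdges (S : Set β)).map (Quot.mk _)

/-- The expectation `𝔼[X]` of a quantity `X S` that depends on the random set `S` of contracted
edges in `H ∼ G(q)`, where each edge of `G` is contracted independently with probability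
`1 - q`. -/
def expect (G : Graph α β) (q : ℝ) (X : Finset β → ℝ) : ℝ :=
  ∑ S ∈ E(G).toFinset.powerset,
    (1 - q) ^ S.card * q ^ (E(G).toFinset \ S).card * X S

/-- The relative second moment `𝔼[X²] / 𝔼[X]²`. -/
def relSecondMoment (G : Graph α β) (q : ℝ) (X : Finset β → ℝ) : ℝ :=
  expect G q (fun S => X S ^ 2) / expect G q X ^ 2

end

end Unreliability

namespace Unreliability

open Classical

noncomputable section

universe u v

variable {α : Type u} {β : Type v} [Fintype β]

/-! Cuts of the contracted graph are the cuts of `G` that avoid the contracted edges, so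
`𝔼[z_H(p/q)] = z_G(p)` and `𝔼[z_H(p/q)²] = ∑ p^(|C|+|D|) q^(-|C∩D|)` over ordered pairs of cuts.
Write `q = p^a`. When `p ≤ q`, so that `a ≤ 1`, the power-mean inequality for the weights
`p^(|C|+|D|) / z²` pulls `a` out of the sum; since `|C|+|D|-|C∩D| = |C∪D|`, the relative second
moment is at most `((z+x)/z²)^a = ((1+x/z)/z)^a` (`second_moment_le_of_rpow`). Below the threshold,
`x/z ≤ 1/log n`.

It remains to see `z^(-a) ≤ 2(1+1/k)` (`inv_rpow_le`). If `γ = λ`, this follows from `z ≥ p^λ` and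
`q^λ = 1/2`. Otherwise the Gomory–Hu edges give distinct cuts, and convexity gives `z ≥ k p^s` with
`s = S_k/k`; the lower bound on `p^λ` and the choice `k ≈ 2^(-2/3) n` absorb the missing quarter of
`s`.

The condition `p ≤ q` is derived for `n ≥ 16`. For `n ≤ 16` a crude constant bound suffices. -/

/-! ### Cuts as edge sets. -/

theorem mem_cutEdges {G : Graph α β} {U : Set α} {e : β} :
    e ∈ cutEdges G U ↔ ∃ x y, G.IsLink e x y ∧ x ∈ U ∧ y ∉ U := by
  simp [cutEdges]

theorem mem_cutEdges_iff_of_isLink {G : Graph α β} {U : Set α} {e : β} {x y : α}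
    (h : G.IsLink e x y) : e ∈ cutEdges G U ↔ ¬ (x ∈ U ↔ y ∈ U) := by
  rw [mem_cutEdges]
  constructor
  · rintro ⟨a, b, hab, ha, hb⟩
    rcases h.eq_and_eq_or_eq_and_eq hab with ⟨rfl, rfl⟩ | ⟨rfl, rfl⟩ <;> tauto
  · intro hxy
    by_cases hx : x ∈ U
    · exact ⟨x, y, h, hx, by tauto⟩
    · exact ⟨y, x, h.symm, by tauto, hx⟩

theorem mem_cuts {G : Graph α β} {C : Finset β} :
    C ∈ cuts G ↔ ∃ U : Set α, U ⊆ V(G) ∧ U.Nonempty ∧ U ≠ V(G) ∧ C = cutEdges G U := by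
  simp [cuts]

theorem subset_edgeSet_of_mem_cuts {G : Graph α β} {C : Finset β} (hC : C ∈ cuts G) :
    C ⊆ E(G).toFinset := by
  obtain ⟨U, -, -, -, rfl⟩ := mem_cuts.1 hC
  intro e he
  obtain ⟨x, y, h, -⟩ := mem_cutEdges.1 he
  simpa using h.edge_mem

theorem minCut_le_card {G : Graph α β} {C : Finset β} (hC : C ∈ cuts G) :
    minCut G ≤ C.card := Nat.sInf_le ⟨C, hC, rfl⟩

theorem exists_card_eq_minCut {G : Graph α β} (h : (cuts G).Nonempty) :
    ∃ C ∈ cuts G, C.card = minCut G := by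
  obtain ⟨C, hC⟩ := h
  exact Nat.sInf_mem (s := {c | ∃ C ∈ cuts G, C.card = c}) ⟨_, C, hC, rfl⟩

theorem cuts_nonempty {G : Graph α β} (h : 2 ≤ V(G).ncard) : (cuts G).Nonempty := by
  obtain ⟨a, ha, b, hb, hab⟩ := (Set.one_lt_ncard (Set.finite_of_ncard_pos (by omega))).1 h
  refine ⟨cutEdges G {a}, mem_cuts.2 ⟨{a}, by simpa, by simp, ?_, rfl⟩⟩
  intro h
  exact hab (by rw [← h] at hb; exact (Set.mem_singleton_iff.1 hb).symm)

/-- In a graph without empty cuts, a cut determines the partition that defines it. -/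
theorem eq_or_eq_diff_of_cutEdges_eq {G : Graph α β} (hG : ∅ ∉ cuts G) {U U' : Set α}
    (hU : U ⊆ V(G)) (hU' : U' ⊆ V(G)) (h : cutEdges G U = cutEdges G U') :
    U = U' ∨ U = V(G) \ U' := by
  by_contra hne
  rw [not_or] at hne
  -- The cut of the symmetric difference of `U` and `U'` is the symmetric difference of their cuts,
  -- hence empty.
  refine hG (mem_cuts.2 ⟨{x ∈ V(G) | ¬ (x ∈ U ↔ x ∈ U')}, fun x hx => hx.1, ?_, ?_, ?_⟩)
  · rw [Set.nonempty_iff_ne_empty]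
    intro hem
    refine hne.1 (Set.ext fun x => ?_)
    by_cases hx : x ∈ V(G)
    · by_contra hx'
      exact (Set.ext_iff.1 hem x).1 ⟨hx, hx'⟩
    · exact ⟨fun h => (hx (hU h)).elim, fun h => (hx (hU' h)).elim⟩
  · intro heq
    refine hne.2 (Set.ext fun x => ?_)
    have := Set.ext_iff.1 heq x
    have h1 := @hU x
    simp only [Set.mem_ofPred_eq, Set.mem_sdiff] at this ⊢
    tauto
  · symm
    rw [Finset.eq_empty_iff_forall_notMem]
    intro e he
    obtain ⟨x, y, hxy, -, -⟩ := mem_cutEdges.1 he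
    rw [mem_cutEdges_iff_of_isLink hxy] at he
    have h1 := mem_cutEdges_iff_of_isLink (U := U) hxy
    rw [h, mem_cutEdges_iff_of_isLink hxy] at h1
    have := hxy.left_mem
    have := hxy.right_mem
    simp only [Set.mem_ofPred_eq] at he
    tauto

theorem card_cuts_le [Fintype α] (G : Graph α β) : (cuts G).card ≤ 2 ^ V(G).ncard := by
  have hsub : cuts G ⊆ (V(G).toFinset.powerset).image fun U : Finset α => cutEdges G U := by
    intro C hC
    obtain ⟨U, hU, -, -, rfl⟩ := mem_cuts.1 hC
    exact Finset.mem_image.2 ⟨U.toFinset, by simpa using hU, by simp⟩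
  refine (Finset.card_le_card hsub).trans (Finset.card_image_le.trans ?_)
  rw [Finset.card_powerset, Set.ncard_eq_toFinset_card']

/-! ### Cuts of a contraction. -/

omit [Fintype β] in
theorem isLink_contract {G : Graph α β} {S : Finset β} {e : β}
    {a b : Quot fun x y : α => ∃ e ∈ S, G.IsLink e x y} :
    (contract G S).IsLink e a b ↔
      ∃ x y, (G.IsLink e x y ∧ e ∉ S) ∧ Quot.mk _ x = a ∧ Quot.mk _ y = b := by
  simp [contract, Relation.Map]

omit [Fintype β] in
theorem vertexSet_contract (G : Graph α β) (S : Finset β) :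
    V(contract G S) = Quot.mk _ '' V(G) := by
  simp [contract]

/-- Vertex sets of the quotient correspond to unions of classes in `G`, and a set is a union of
classes exactly when no edge of `S` crosses it. -/
theorem cuts_contract (G : Graph α β) (S : Finset β) :
    cuts (contract G S) = (cuts G).filter fun C => Disjoint S C := by
  ext C
  rw [Finset.mem_filter, mem_cuts, mem_cuts]
  constructor
  · rintro ⟨U, hU, ⟨a, ha⟩, hne, rfl⟩
    have hlink : ∀ e x y, G.IsLink e x y → e ∈ S →
        ((Quot.mk _ x : Quot fun x y : α => ∃ e ∈ S, G.IsLink e x y) = Quot.mk _ y) :=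
      fun e x y h he => Quot.sound ⟨e, he, h⟩
    refine ⟨⟨{x ∈ V(G) | Quot.mk _ x ∈ U}, fun x hx => hx.1, ?_, ?_, ?_⟩, ?_⟩
    · have := hU ha
      rw [vertexSet_contract] at this
      obtain ⟨x, hx, rfl⟩ := this
      exact ⟨x, hx, ha⟩
    · intro heq
      refine hne (hU.antisymm ?_)
      rw [vertexSet_contract]
      rintro _ ⟨x, hx, rfl⟩
      rw [← heq] at hx
      exact hx.2
    · ext e
      rw [mem_cutEdges, mem_cutEdges]
      constructor
      · rintro ⟨a, b, hab, ha, hb⟩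
        obtain ⟨x, y, ⟨hxy, he⟩, rfl, rfl⟩ := isLink_contract.1 hab
        exact ⟨x, y, hxy, ⟨hxy.left_mem, ha⟩, fun h => hb h.2⟩
      · rintro ⟨x, y, hxy, hx, hy⟩
        have hy' : Quot.mk _ y ∉ U := fun h => hy ⟨hxy.right_mem, h⟩
        refine ⟨_, _, isLink_contract.2 ⟨x, y, ⟨hxy, fun he => hy' ?_⟩, rfl, rfl⟩, hx.2, hy'⟩
        rw [← hlink e x y hxy he]
        exact hx.2
    · rw [Finset.disjoint_left]
      intro e he he'
      obtain ⟨a, b, hab, -⟩ := mem_cutEdges.1 he'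
      obtain ⟨x, y, ⟨-, h⟩, -⟩ := isLink_contract.1 hab
      exact h he
  · rintro ⟨⟨U, hU, ⟨a, ha⟩, hne, rfl⟩, hdis⟩
    have key : ∀ x y : α, (Quot.mk _ x : Quot fun x y : α => ∃ e ∈ S, G.IsLink e x y)
        = Quot.mk _ y → (x ∈ U ↔ y ∈ U) := by
      intro x y h
      refine iff_of_eq (congrArg (Quot.lift (fun x => x ∈ U) ?_) h)
      rintro x y ⟨e, he, hl⟩
      by_contra hc
      exact Finset.disjoint_left.1 hdis he
        ((mem_cutEdges_iff_of_isLink hl).2 fun h => hc (propext h))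
    have hmem : ∀ x, (Quot.mk _ x : Quot fun x y : α => ∃ e ∈ S, G.IsLink e x y) ∈
        Quot.mk _ '' U ↔ x ∈ U := by
      intro x
      constructor
      · rintro ⟨y, hy, h⟩
        exact (key _ _ h).1 hy
      · exact fun h => ⟨x, h, rfl⟩
    refine ⟨Quot.mk _ '' U, ?_, ⟨_, a, ha, rfl⟩, ?_, ?_⟩
    · rw [vertexSet_contract]
      exact Set.image_mono hU
    · rw [vertexSet_contract]
      intro heq
      refine hne (hU.antisymm fun x hx => (hmem x).1 ?_)
      rw [heq]
      exact ⟨x, hx, rfl⟩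
    · ext e
      rw [mem_cutEdges, mem_cutEdges]
      constructor
      · rintro ⟨x, y, hxy, hx, hy⟩
        refine ⟨_, _, isLink_contract.2 ⟨x, y, ⟨hxy, fun he => ?_⟩, rfl, rfl⟩,
          (hmem x).2 hx, fun h => hy ((hmem y).1 h)⟩
        exact Finset.disjoint_left.1 hdis he (mem_cutEdges.2 ⟨x, y, hxy, hx, hy⟩)
      · rintro ⟨a, b, hab, ha, hb⟩
        obtain ⟨x, y, ⟨hxy, -⟩, rfl, rfl⟩ := isLink_contract.1 hab
        exact ⟨x, y, hxy, (hmem x).1 ha, fun h => hb ((hmem y).2 h)⟩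

/-! ### Moments of `z_H` under random contraction. -/

theorem zCut_contract (G : Graph α β) (S : Finset β) (r : ℝ) :
    zCut (contract G S) r = ∑ C ∈ cuts G, if Disjoint S C then r ^ C.card else 0 := by
  rw [zCut, cuts_contract, Finset.sum_filter]

/-- A set `C` of edges survives in `H ∼ G(q)` with probability `q ^ |C|`. -/
theorem expect_disjoint (G : Graph α β) (q c : ℝ) {C : Finset β} (hC : C ⊆ E(G).toFinset) :
    expect G q (fun S => if Disjoint S C then c else 0) = q ^ C.card * c := by
  have hfilter : E(G).toFinset.powerset.filter (fun S => Disjoint S C)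
      = (E(G).toFinset \ C).powerset := by
    ext S
    simp [Finset.subset_sdiff]
  simp only [expect, mul_ite, mul_zero]
  rw [← Finset.sum_filter, hfilter, ← Finset.sum_mul]
  congr 1
  -- The edges outside `C` are unconstrained, so their total probability is `((1 - q) + q)^|E \ C| =
  -- 1`.
  have h1 := Finset.sum_pow_mul_eq_add_pow (1 - q) q (E(G).toFinset \ C)
  rw [sub_add_cancel, one_pow] at h1
  refine Eq.trans ?_ ((congrArg (q ^ C.card * ·) h1).trans (mul_one _))
  rw [Finset.mul_sum]
  refine Finset.sum_congr rfl fun S hS => ?_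
  have hS' := Finset.subset_sdiff.1 (Finset.mem_powerset.1 hS)
  have e1 := Finset.card_sdiff_of_subset hS'.1
  have e2 := Finset.card_sdiff_of_subset (Finset.mem_powerset.1 hS)
  have e3 := Finset.card_sdiff_of_subset hC
  have l1 := Finset.card_le_card (Finset.mem_powerset.1 hS)
  have l2 := Finset.card_le_card hC
  have : (E(G).toFinset \ S).card = C.card + ((E(G).toFinset \ C).card - S.card) := by omega
  rw [this, pow_add, mul_left_comm]

theorem expect_sum {ι : Type*} (G : Graph α β) (q : ℝ) (s : Finset ι) (X : ι → Finset β → ℝ) :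
    expect G q (fun S => ∑ i ∈ s, X i S) = ∑ i ∈ s, expect G q (X i) := by
  simp only [expect, Finset.mul_sum]
  exact Finset.sum_comm

theorem expect_zCut_contract (G : Graph α β) {p q : ℝ} (hq : q ≠ 0) :
    expect G q (fun S => zCut (contract G S) (p / q)) = zCut G p := by
  simp only [zCut_contract, expect_sum]
  refine Finset.sum_congr rfl fun C hC => ?_
  rw [expect_disjoint _ _ _ (subset_edgeSet_of_mem_cuts hC), div_pow, mul_div_cancel₀]
  exact pow_ne_zero _ hq

theorem expect_zCut_contract_sq (G : Graph α β) {p q : ℝ} (hq : q ≠ 0) :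
    expect G q (fun S => zCut (contract G S) (p / q) ^ 2) =
      ∑ P ∈ cuts G ×ˢ cuts G, p ^ P.1.card * p ^ P.2.card * (q ^ (P.1 ∩ P.2).card)⁻¹ := by
  have h : ∀ S, zCut (contract G S) (p / q) ^ 2 = ∑ P ∈ cuts G ×ˢ cuts G,
      if Disjoint S (P.1 ∪ P.2) then (p / q) ^ P.1.card * (p / q) ^ P.2.card else 0 := by
    intro S
    rw [zCut_contract, sq, Finset.sum_mul_sum, ← Finset.sum_product']
    refine Finset.sum_congr rfl fun P _ => ?_
    simp only [Finset.disjoint_union_right]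
    split_ifs <;> simp_all
  simp only [h, expect_sum]
  refine Finset.sum_congr rfl fun P hP => ?_
  rw [Finset.mem_product] at hP
  rw [expect_disjoint _ _ _ (Finset.union_subset (subset_edgeSet_of_mem_cuts hP.1)
    (subset_edgeSet_of_mem_cuts hP.2))]
  have hcard : q ^ (P.1 ∪ P.2).card * q ^ (P.1 ∩ P.2).card = q ^ P.1.card * q ^ P.2.card := by
    rw [← pow_add, ← pow_add, Finset.card_union_add_card_inter]
  rw [div_pow, div_pow]
  field_simp
  linear_combination p ^ P.1.card * p ^ P.2.card * hcard

/-! ### Cuts defined by Gomory–Hu tree edges. -/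

/-- Every edge of a tree is the only edge across some vertex set. -/
theorem exists_fundamental_cut {W : Type u} {Y : SimpleGraph W} (hY : Y.IsTree) {e : Sym2 W}
    (he : e ∈ Y.edgeSet) :
    ∃ U : Set W, ∀ f ∈ Y.edgeSet, (∃ x y, f = s(x, y) ∧ x ∈ U ∧ y ∉ U) ↔ f = e := by
  induction e with | h x y =>
  have hb := SimpleGraph.isAcyclic_iff_forall_isBridge.1 hY.isAcyclic he
  -- The side of `x` after deleting the bridge `s(x, y)`.
  refine ⟨{v | (Y.deleteEdges {s(x, y)}).Reachable x v}, fun f hf => ⟨?_, ?_⟩⟩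
  · rintro ⟨a, b, rfl, ha, hb'⟩
    by_contra hne
    refine hb' (SimpleGraph.Reachable.trans ha (SimpleGraph.Adj.reachable ?_))
    rw [SimpleGraph.deleteEdges_adj]
    exact ⟨hf, hne⟩
  · rintro rfl
    exact ⟨x, y, rfl, SimpleGraph.Reachable.refl _, hb⟩

theorem weightedCutValue_eq {W : Type u} [Fintype W] {Y : SimpleGraph W} (w : Sym2 W → ℕ)
    {e : Sym2 W} (he : e ∈ Y.edgeSet) {U : Set W}
    (hU : ∀ f ∈ Y.edgeSet, (∃ x y, f = s(x, y) ∧ x ∈ U ∧ y ∉ U) ↔ f = e) :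
    weightedCutValue Y w U = w e := by
  have : Y.edgeFinset.filter (fun e => ∃ x y, e = s(x, y) ∧ x ∈ U ∧ y ∉ U) = {e} := by
    ext f
    rw [Finset.mem_filter, Finset.mem_singleton, SimpleGraph.mem_edgeFinset]
    exact ⟨fun h => (hU f h.1).1 h.2, fun h => ⟨h ▸ he, (hU f (h ▸ he)).2 h⟩⟩
  rw [weightedCutValue, this, Finset.sum_singleton]

theorem le_weightedCutValue {W : Type u} [Fintype W] {Y : SimpleGraph W} (w : Sym2 W → ℕ)
    {x y : W} (he : s(x, y) ∈ Y.edgeSet) {U : Set W} (hx : x ∈ U) (hy : y ∉ U) :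
    w s(x, y) ≤ weightedCutValue Y w U :=
  Finset.single_le_sum (f := w) (fun _ _ => Nat.zero_le _)
    (Finset.mem_filter.2 ⟨SimpleGraph.mem_edgeFinset.2 he, x, y, rfl, hx, hy⟩)

/-- Every edge of a Gomory–Hu tree defines a cut of `G` whose size is the weight of the edge. -/
theorem IsGomoryHuTree.exists_cut [Fintype α] {G : Graph α β} {Y : SimpleGraph V(G)}
    {w : Sym2 V(G) → ℕ} (h : IsGomoryHuTree G Y w) {e : Sym2 V(G)} (he : e ∈ Y.edgeSet) :
    ∃ U : Set V(G), (∀ f ∈ Y.edgeSet, (∃ x y, f = s(x, y) ∧ x ∈ U ∧ y ∉ U) ↔ f = e) ∧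
      cutEdges G (Subtype.val '' U) ∈ cuts G ∧
      (cutEdges G (Subtype.val '' U)).card = w e := by
  obtain ⟨U, hU⟩ := exists_fundamental_cut h.1 he
  obtain ⟨x, y, rfl, hx, hy⟩ := (hU e he).2 rfl
  have hval := weightedCutValue_eq w he hU
  -- Every set separating `x` from `y` is crossed by the tree edge `s(x, y)`, so it costs at least
  -- that weight.
  have hmin : IsMinSTCut (weightedCutValue Y w) x y U :=
    ⟨hx, hy, fun U' hx' hy' => hval ▸ le_weightedCutValue w he hx' hy'⟩
  refine ⟨U, hU, mem_cuts.2 ⟨Subtype.val '' U, ?_, ⟨_, x, hx, rfl⟩, ?_, rfl⟩, ?_⟩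
  · rintro _ ⟨v, -, rfl⟩
    exact v.2
  · intro heq
    obtain ⟨v, hv, hvy⟩ := heq.ge y.2
    exact hy (Subtype.ext hvy ▸ hv)
  · rw [← hval]
    exact (h.2 x y (fun hxy => hy (hxy ▸ hx)) U hmin).2

theorem IsGomoryHuTree.minCut_le [Fintype α] {G : Graph α β} {Y : SimpleGraph V(G)}
    {w : Sym2 V(G) → ℕ} (h : IsGomoryHuTree G Y w) {e : Sym2 V(G)} (he : e ∈ Y.edgeSet) :
    minCut G ≤ w e := by
  obtain ⟨U, -, hU, hcard⟩ := h.exists_cut he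
  exact hcard ▸ minCut_le_card hU

/-- Distinct tree edges give distinct cuts: without empty cuts, equal cuts come from equal or
complementary sides, and each side is crossed by only one tree edge. -/
theorem IsGomoryHuTree.sum_le_zCut [Fintype α] {G : Graph α β} {Y : SimpleGraph V(G)}
    {w : Sym2 V(G) → ℕ} (h : IsGomoryHuTree G Y w) (hG : ∅ ∉ cuts G) {p : ℝ} (hp : 0 ≤ p) :
    ∑ e ∈ Y.edgeFinset, p ^ w e ≤ zCut G p := by
  have hex : ∀ e : Sym2 V(G), ∃ U : Set V(G), e ∈ Y.edgeSet →
      (∀ f ∈ Y.edgeSet, (∃ x y, f = s(x, y) ∧ x ∈ U ∧ y ∉ U) ↔ f = e) ∧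
      cutEdges G (Subtype.val '' U) ∈ cuts G ∧
      (cutEdges G (Subtype.val '' U)).card = w e := by
    intro e
    by_cases he : e ∈ Y.edgeSet
    · obtain ⟨U, hU⟩ := h.exists_cut he
      exact ⟨U, fun _ => hU⟩
    · exact ⟨∅, fun h => (he h).elim⟩
  choose U hU using hex
  have hinj : Set.InjOn (fun e => cutEdges G (Subtype.val '' U e)) Y.edgeFinset := by
    intro e he f hf hef
    rw [SimpleGraph.coe_edgeFinset] at he hf
    have hsub : ∀ e, Subtype.val '' U e ⊆ V(G) := by
      rintro e _ ⟨v, -, rfl⟩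
      exact v.2
    refine ((hU f hf).1 e he).1 ?_
    obtain ⟨x, y, rfl, hx, hy⟩ := ((hU e he).1 e he).2 rfl
    have hmem : ∀ (v : V(G)) e, v ∈ U e ↔ (v : α) ∈ Subtype.val '' U e := by simp
    rw [hmem] at hx hy
    rcases eq_or_eq_diff_of_cutEdges_eq hG (hsub _) (hsub _) hef with heq | heq
    · rw [heq, ← hmem] at hx hy
      exact ⟨x, y, rfl, hx, hy⟩
    · rw [heq, Set.mem_sdiff, ← hmem] at hx hy
      exact ⟨y, x, Sym2.eq_swap, by simpa using hy, hx.2⟩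
  rw [zCut]
  calc ∑ e ∈ Y.edgeFinset, p ^ w e
      = ∑ e ∈ Y.edgeFinset, p ^ (cutEdges G (Subtype.val '' U e)).card :=
        Finset.sum_congr rfl fun e he => by
          rw [(hU e (SimpleGraph.mem_edgeFinset.1 he)).2.2]
    _ = ∑ C ∈ Y.edgeFinset.image fun e => cutEdges G (Subtype.val '' U e), p ^ C.card :=
        (Finset.sum_image (f := fun C : Finset β => p ^ C.card) hinj).symm
    _ ≤ ∑ C ∈ cuts G, p ^ C.card := by
        refine Finset.sum_le_sum_of_subset_of_nonneg ?_ fun _ _ _ => pow_nonneg hp _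
        intro C hC
        obtain ⟨e, he, rfl⟩ := Finset.mem_image.1 hC
        exact (hU e (SimpleGraph.mem_edgeFinset.1 he)).2.1

/-! ### Lower bounds on `z_G` and use of the threshold. -/

/-- Each `p ^ m` lies above the tangent at `s` of the convex function `m ↦ p ^ m`. When `s` is the
mean of `l`, the linear term vanishes. -/
theorem length_mul_le_sum_map_pow (l : List ℕ) {p : ℝ} (hp : 0 < p) (s : ℝ) :
    p ^ s * (l.length + (l.sum - l.length * s) * Real.log p) ≤ (l.map fun m => p ^ m).sum := by
  induction l with
  | nil => simp
  | cons m l ih =>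
    have h : p ^ s * (1 + (m - s) * Real.log p) ≤ p ^ m := by
      have h1 := Real.add_one_le_exp ((m - s) * Real.log p)
      have h2 : p ^ m = p ^ s * Real.exp ((m - s) * Real.log p) := by
        rw [mul_comm _ (Real.log p), ← Real.rpow_def_of_pos hp, ← Real.rpow_add hp,
          add_sub_cancel, Real.rpow_natCast]
      rw [h2]
      exact mul_le_mul_of_nonneg_left (by linarith) (Real.rpow_nonneg hp.le _)
    simp only [List.length_cons, List.sum_cons, List.map_cons]
    rw [Nat.cast_add, Nat.cast_add, Nat.cast_one]
    linarith

theorem length_weights {W : Type u} [Fintype W] (Y : SimpleGraph W) (w : Sym2 W → ℕ) :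
    ((Y.edgeFinset.val.map w).sort (· ≤ ·)).length = Y.edgeFinset.card := by
  simp

theorem mul_rpow_le_sum_pow {W : Type u} [Fintype W] (Y : SimpleGraph W) (w : Sym2 W → ℕ) {k : ℕ}
    (hk : k ≠ 0) (hkY : k ≤ Y.edgeFinset.card) {p : ℝ} (hp : 0 < p) :
    k * p ^ ((sumSmallest Y w k : ℝ) / k) ≤ ∑ e ∈ Y.edgeFinset, p ^ w e := by
  set l := (Y.edgeFinset.val.map w).sort (· ≤ ·) with hl
  have hlen : (l.take k).length = k := by
    rw [List.length_take, hl, length_weights, min_eq_left hkY]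
  have h1 := length_mul_le_sum_map_pow (l.take k) hp ((sumSmallest Y w k : ℝ) / k)
  have hk' : (k : ℝ) ≠ 0 := Nat.cast_ne_zero.2 hk
  have hs : (l.take k).sum = sumSmallest Y w k := rfl
  rw [hlen, hs, mul_div_cancel₀ _ hk', sub_self, zero_mul, add_zero, mul_comm] at h1
  refine h1.trans ?_
  have h2 : ∑ e ∈ Y.edgeFinset, p ^ w e = (l.map fun m => p ^ m).sum := by
    change (Multiset.map ((fun m => p ^ m) ∘ w) Y.edgeFinset.val).sum = _
    rw [← Multiset.map_map (fun m => p ^ m) w, ← Multiset.sum_coe,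
      ← Multiset.map_coe, hl, Multiset.sort_eq]
  rw [h2]
  conv_rhs => rw [← List.take_append_drop k l, List.map_append, List.sum_append]
  refine le_add_of_nonneg_right (List.sum_nonneg ?_)
  intro x hx
  obtain ⟨m, -, rfl⟩ := List.mem_map.1 hx
  positivity

theorem mul_le_sumSmallest {W : Type u} [Fintype W] (Y : SimpleGraph W) (w : Sym2 W → ℕ) {k m : ℕ}
    (hkY : k ≤ Y.edgeFinset.card) (hw : ∀ e ∈ Y.edgeSet, m ≤ w e) :
    k * m ≤ sumSmallest Y w k := by
  have h := List.card_nsmul_le_sum (((Y.edgeFinset.val.map w).sort (· ≤ ·)).take k) m (by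
    intro x hx
    have := List.mem_of_mem_take hx
    rw [Multiset.mem_sort, Multiset.mem_map] at this
    obtain ⟨e, he, rfl⟩ := this
    exact hw e (SimpleGraph.mem_edgeFinset.1 he))
  rwa [List.length_take, length_weights, min_eq_left hkY] at h

theorem pow_minCut_le_zCut {G : Graph α β} (hG : (cuts G).Nonempty) {p : ℝ} (hp : 0 ≤ p) :
    p ^ minCut G ≤ zCut G p := by
  obtain ⟨C, hC, hcard⟩ := exists_card_eq_minCut hG
  rw [← hcard]
  exact Finset.single_le_sum (f := fun C : Finset β => p ^ C.card)
    (fun _ _ => pow_nonneg hp _) hC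

theorem xCut_div_zCut_le (G : Graph α β) {p : ℝ} (hp : 0 < p) (h : p < theta G) :
    xCut G p / zCut G p ≤ 1 / Real.logb 2 (V(G).ncard : ℝ) := by
  obtain ⟨t, ht, hpt⟩ := exists_lt_of_lt_csSup
    (by exact ⟨0, le_rfl, zero_le_one, fun p h0 h1 => (lt_asymm h0 h1).elim⟩) h
  exact ht.2.2 p hp hpt

/-! ### The power-mean bound and the estimate of `z^(-a)`. -/

theorem sum_pow_card_union (G : Graph α β) (p : ℝ) :
    ∑ P ∈ cuts G ×ˢ cuts G, p ^ (P.1 ∪ P.2).card = zCut G p + xCut G p := by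
  rw [← Finset.diag_union_offDiag, Finset.sum_union (Finset.disjoint_diag_offDiag _),
    Finset.sum_diag]
  simp [zCut, xCut]

theorem sum_pow_mul_pow (G : Graph α β) (p : ℝ) :
    ∑ P ∈ cuts G ×ˢ cuts G, p ^ P.1.card * p ^ P.2.card = zCut G p ^ 2 := by
  rw [zCut, sq, Finset.sum_mul_sum, ← Finset.sum_product']

theorem second_moment_le_of_rpow (G : Graph α β) {p a : ℝ} (hp : 0 < p) (ha : 0 < a)
    (ha1 : a ≤ 1) (hz : 0 < zCut G p) :
    (∑ P ∈ cuts G ×ˢ cuts G,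
      p ^ P.1.card * p ^ P.2.card * ((p ^ a) ^ (P.1 ∩ P.2).card)⁻¹) / zCut G p ^ 2 ≤
      ((zCut G p + xCut G p) / zCut G p ^ 2) ^ a := by
  have h := Real.arith_mean_le_rpow_mean (cuts G ×ˢ cuts G)
    (fun P => p ^ P.1.card * p ^ P.2.card / zCut G p ^ 2)
    (fun P => ((p ^ a) ^ (P.1 ∩ P.2).card)⁻¹) (fun P _ => by positivity)
    (by rw [← Finset.sum_div, sum_pow_mul_pow, div_self (by positivity)])
    (fun P _ => by positivity) (p := 1 / a) (by rwa [le_div_iff₀ ha, one_mul])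
  rw [one_div_one_div] at h
  convert h using 1
  · rw [Finset.sum_div]
    exact Finset.sum_congr rfl fun P _ => by ring
  · congr 1
    rw [← sum_pow_card_union, Finset.sum_div]
    refine Finset.sum_congr rfl fun P _ => ?_
    have h1 : ((((p ^ a) ^ (P.1 ∩ P.2).card)⁻¹ : ℝ)) ^ (1 / a) = (p ^ (P.1 ∩ P.2).card)⁻¹ := by
      rw [Real.inv_rpow (by positivity), ← Real.rpow_natCast, ← Real.rpow_mul hp.le,
        ← Real.rpow_mul hp.le, ← Real.rpow_natCast]
      congr 2
      field_simp
    have h2 : p ^ (P.1 ∪ P.2).card * p ^ (P.1 ∩ P.2).card = p ^ P.1.card * p ^ P.2.card := by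
      rw [← pow_add, ← pow_add, Finset.card_union_add_card_inter]
    rw [h1, ← h2]
    field_simp

theorem inv_rpow_le {z p a s n : ℝ} {l k : ℕ} (hp : 0 < p) (hp1 : p < 1) (ha : 0 < a)
    (ha1 : a ≤ 1) (hn : 0 < n) (hk : k ≠ 0) (hkn : (2 : ℝ) ^ (-(2 / 3) : ℝ) * n < k + 1)
    (hq : (p ^ a) ^ min (l : ℝ) (3 / 4 * s) = 1 / 2) (hz : p ^ l ≤ z) (hz' : k * p ^ s ≤ z)
    (hpl : 4 * n ^ (-3 : ℝ) ≤ p ^ l) :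
    z⁻¹ ^ a ≤ 2 * (1 + 1 / k) := by
  have hk0 : (0 : ℝ) < k := Nat.cast_pos.2 (Nat.pos_of_ne_zero hk)
  have hz0 : 0 < z := lt_of_lt_of_le (by positivity) hz
  rcases le_total (l : ℝ) (3 / 4 * s) with hls | hls
  · rw [min_eq_left hls, Real.rpow_natCast] at hq
    have h1 : z⁻¹ ^ a ≤ (p ^ l)⁻¹ ^ a := by gcongr
    have h2 : (p ^ l)⁻¹ ^ a = 2 := by
      rw [Real.inv_rpow (by positivity), ← Real.rpow_natCast, ← Real.rpow_mul hp.le,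
        mul_comm, Real.rpow_mul hp.le, Real.rpow_natCast, hq]
      norm_num
    rw [h2] at h1
    have : (0 : ℝ) ≤ 1 / k := by positivity
    linarith
  · rw [min_eq_right hls] at hq
    have h1 : z⁻¹ ^ a ≤ (k * p ^ s)⁻¹ ^ a := by gcongr
    -- Split `s = 3s/4 + s/4`: the first part contributes `q^(-γ) = 2`.
    have h2 : (k * p ^ s)⁻¹ ^ a = 2 * ((p ^ (s / 4))⁻¹ * (k : ℝ)⁻¹) ^ a := by
      have e1 : (p ^ s) ^ a = (p ^ a) ^ (3 / 4 * s) * (p ^ (s / 4)) ^ a := by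
        rw [← Real.rpow_mul hp.le, ← Real.rpow_mul hp.le, ← Real.rpow_mul hp.le,
          ← Real.rpow_add hp]
        congr 1
        ring
      rw [hq] at e1
      rw [Real.inv_rpow (by positivity), Real.mul_rpow (by positivity) (by positivity), e1,
        Real.mul_rpow (by positivity) (by positivity), Real.inv_rpow (by positivity),
        Real.inv_rpow (by positivity)]
      field_simp
    have h3 : (p ^ (s / 4))⁻¹ ≤ k + 1 := by
      refine le_trans ?_ hkn.le
      -- In this case `s/4 ≤ l/3`. The cube root of `4 n^(-3)` is the inverse of `2^(-2/3) n`, which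
      -- explains the choice of `k`.
      have e2 : (4 * n ^ (-3 : ℝ)) ^ (1 / 3 : ℝ) ≤ p ^ (s / 4) :=
        calc (4 * n ^ (-3 : ℝ)) ^ (1 / 3 : ℝ) ≤ (p ^ l) ^ (1 / 3 : ℝ) := by gcongr
          _ = p ^ ((l : ℝ) * (1 / 3)) := by rw [Real.rpow_mul hp.le, Real.rpow_natCast]
          _ ≤ p ^ (s / 4) := Real.rpow_le_rpow_of_exponent_ge hp hp1.le (by linarith)
      have e3 : (4 * n ^ (-3 : ℝ)) ^ (1 / 3 : ℝ) = ((2 : ℝ) ^ (-(2 / 3) : ℝ) * n)⁻¹ := by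
        rw [Real.mul_rpow (by norm_num) (by positivity), ← Real.rpow_mul hn.le, mul_inv,
          ← Real.rpow_neg (by norm_num), show (4 : ℝ) = 2 ^ (2 : ℝ) by norm_num,
          ← Real.rpow_mul (by norm_num), ← Real.rpow_neg_one n]
        norm_num
      rw [e3] at e2
      exact inv_le_of_inv_le₀ (by positivity) e2
    have h4 : ((p ^ (s / 4))⁻¹ * (k : ℝ)⁻¹) ^ a ≤ 1 + 1 / k := by
      calc ((p ^ (s / 4))⁻¹ * (k : ℝ)⁻¹) ^ a ≤ (1 + 1 / k) ^ a := by
            refine Real.rpow_le_rpow (by positivity) ?_ ha.le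
            calc (p ^ (s / 4))⁻¹ * (k : ℝ)⁻¹ ≤ (k + 1) * (k : ℝ)⁻¹ := by gcongr
              _ = 1 + 1 / k := by field_simp
        _ ≤ (1 + 1 / k : ℝ) ^ (1 : ℝ) :=
            Real.rpow_le_rpow_of_exponent_le (by simp) ha1
        _ = 1 + 1 / k := Real.rpow_one _
    rw [h2] at h1
    linarith

/-! ### Crude bound for few vertices. -/

/-- A graph on two vertices has a single cut. -/
theorem eq_of_mem_cuts_of_ncard_eq_two {G : Graph α β} (hG : V(G).ncard = 2) {C D : Finset β}
    (hC : C ∈ cuts G) (hD : D ∈ cuts G) : C = D := by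
  obtain ⟨a, b, hab, hV⟩ := Set.ncard_eq_two.1 hG
  have key : ∀ C ∈ cuts G, ∀ e x y, G.IsLink e x y → (e ∈ C ↔ x ≠ y) := by
    intro C hC e x y hxy
    obtain ⟨U, hU, ⟨u, hu⟩, hne, rfl⟩ := mem_cuts.1 hC
    rw [mem_cutEdges_iff_of_isLink hxy]
    have hx := hxy.left_mem
    have hy := hxy.right_mem
    have hu' := hU hu
    have hne' : ¬ (a ∈ U ∧ b ∈ U) := by
      rintro ⟨h1, h2⟩
      refine hne (hU.antisymm ?_)
      rw [hV]
      rintro v (rfl | rfl) <;> assumption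
    rw [hV] at hx hy hu'
    rcases hx with rfl | rfl <;> rcases hy with rfl | rfl <;> rcases hu' with rfl | rfl <;> tauto
  ext e
  by_cases he : ∃ x y, G.IsLink e x y
  · obtain ⟨x, y, h⟩ := he
    rw [key C hC e x y h, key D hD e x y h]
  · have hno : ∀ C ∈ cuts G, e ∉ C := by
      intro C hC heC
      have := subset_edgeSet_of_mem_cuts hC heC
      rw [Set.mem_toFinset] at this
      exact he (G.exists_isLink_of_mem_edgeSet this)
    simp [hno C hC, hno D hD]

/-- With `l = minCut G`, every summand is at most `p^(2l) q^(-l)`, while `z ≥ p^l`. A larger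
intersection, of size `i > l`, gives at most `(p²/q)^i`, which is no worse when `p² ≤ q`. -/
theorem second_moment_le_of_card (G : Graph α β) {p q : ℝ} (hp : 0 < p) (hp1 : p ≤ 1)
    (hq : 0 < q) (hq1 : q ≤ 1) (hG : (cuts G).Nonempty)
    (h : p ^ 2 ≤ q ∨ ∀ C ∈ cuts G, C.card ≤ minCut G) :
    (∑ P ∈ cuts G ×ˢ cuts G,
      p ^ P.1.card * p ^ P.2.card * (q ^ (P.1 ∩ P.2).card)⁻¹) / zCut G p ^ 2 ≤
      (cuts G).card ^ 2 * (q ^ minCut G)⁻¹ := by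
  set l := minCut G with hl
  have hterm : ∀ P ∈ cuts G ×ˢ cuts G,
      p ^ P.1.card * p ^ P.2.card * (q ^ (P.1 ∩ P.2).card)⁻¹ ≤ (p ^ l) ^ 2 * (q ^ l)⁻¹ := by
    intro P hP
    rw [Finset.mem_product] at hP
    have h1 := minCut_le_card hP.1
    have h2 := minCut_le_card hP.2
    have i1 : (P.1 ∩ P.2).card ≤ P.1.card := Finset.card_le_card Finset.inter_subset_left
    have i2 : (P.1 ∩ P.2).card ≤ P.2.card := Finset.card_le_card Finset.inter_subset_right
    rcases le_or_gt (P.1 ∩ P.2).card l with hi | hi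
    · rw [sq]
      gcongr ?_ * ?_ * ?_⁻¹
      · exact pow_le_pow_of_le_one hp.le hp1 h1
      · exact pow_le_pow_of_le_one hp.le hp1 h2
      · exact pow_le_pow_of_le_one hq.le hq1 hi
    · have hpq : p ^ 2 ≤ q := h.resolve_right fun h => by
        have := h _ hP.1
        omega
      calc p ^ P.1.card * p ^ P.2.card * (q ^ (P.1 ∩ P.2).card)⁻¹
          ≤ p ^ (P.1 ∩ P.2).card * p ^ (P.1 ∩ P.2).card * (q ^ (P.1 ∩ P.2).card)⁻¹ := by
            gcongr ?_ * ?_ * _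
            · exact pow_le_pow_of_le_one hp.le hp1 i1
            · exact pow_le_pow_of_le_one hp.le hp1 i2
        _ = (p ^ 2 * q⁻¹) ^ (P.1 ∩ P.2).card := by rw [mul_pow, inv_pow, ← mul_pow, sq]
        _ ≤ (p ^ 2 * q⁻¹) ^ l := by
            refine pow_le_pow_of_le_one (by positivity) ?_ hi.le
            rw [← div_eq_mul_inv]
            exact (div_le_one hq).2 hpq
        _ = (p ^ l) ^ 2 * (q ^ l)⁻¹ := by rw [mul_pow, inv_pow, pow_right_comm]
  have hz := pow_minCut_le_zCut hG hp.le
  have hz0 : 0 < zCut G p := lt_of_lt_of_le (by positivity) hz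
  rw [div_le_iff₀ (by positivity)]
  calc _ ≤ ∑ P ∈ cuts G ×ˢ cuts G, (p ^ l) ^ 2 * (q ^ l)⁻¹ := Finset.sum_le_sum hterm
    _ = (cuts G).card ^ 2 * (q ^ l)⁻¹ * (p ^ l) ^ 2 := by
        rw [Finset.sum_const, Finset.card_product, nsmul_eq_mul]
        push_cast
        ring
    _ ≤ _ := by gcongr

/-! ### The two ranges of `n`. -/

theorem relSecondMoment_eq (G : Graph α β) {p q : ℝ} (hq : q ≠ 0) :
    relSecondMoment G q (fun S => zCut (contract G S) (p / q)) =
      (∑ P ∈ cuts G ×ˢ cuts G,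
        p ^ P.1.card * p ^ P.2.card * (q ^ (P.1 ∩ P.2).card)⁻¹) / zCut G p ^ 2 := by
  rw [relSecondMoment, expect_zCut_contract_sq G hq, expect_zCut_contract G hq]

theorem gammaParam_bounds [Fintype α] {G : Graph α β} {Y : SimpleGraph V(G)}
    {w : Sym2 V(G) → ℕ} (h : IsGomoryHuTree G Y w) {k : ℕ} (hk : k ≠ 0)
    (hkn : k < V(G).ncard) :
    3 / 4 * (minCut G : ℝ) ≤ gammaParam G Y w k ∧ gammaParam G Y w k ≤ minCut G ∧
      k ≤ Y.edgeFinset.card := by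
  have hcard : k ≤ Y.edgeFinset.card := by
    have h1 := h.1.card_edgeFinset
    rw [← Nat.card_eq_fintype_card, Nat.card_coe_set_eq] at h1
    omega
  have h1 := mul_le_sumSmallest Y w hcard fun e he => h.minCut_le he
  have hk0 : (0 : ℝ) < k := Nat.cast_pos.2 (Nat.pos_of_ne_zero hk)
  have h2 : (minCut G : ℝ) ≤ (sumSmallest Y w k : ℝ) / k := by
    rw [le_div_iff₀ hk0, mul_comm]
    exact_mod_cast h1
  have h3 : (0 : ℝ) ≤ minCut G := Nat.cast_nonneg _
  exact ⟨le_min (by linarith) (by linarith), min_le_left _ _, hcard⟩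

theorem logb_two_le_self {n : ℕ} : Real.logb 2 n ≤ n := by
  rcases n.eq_zero_or_pos with rfl | hn
  · simp
  · rw [Real.logb_le_iff_le_rpow (by norm_num) (by exact_mod_cast hn), Real.rpow_natCast]
    exact_mod_cast Nat.lt_two_pow_self.le

theorem relSecondMoment_le_of_large [Fintype α] {G : Graph α β} (hn : 2 ≤ V(G).ncard)
    {Y : SimpleGraph V(G)} {w : Sym2 V(G) → ℕ} (h : IsGomoryHuTree G Y w) {k : ℕ}
    (hk : k ≠ 0) (hkn : k < V(G).ncard)
    (hkn' : (2 : ℝ) ^ (-(2 / 3) : ℝ) * (V(G).ncard : ℝ) < k + 1)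
    (hkL : 1 / (k : ℝ) ≤ 4 / Real.logb 2 (V(G).ncard : ℝ)) (hL : 1 ≤ Real.logb 2 (V(G).ncard : ℝ))
    {p q : ℝ} (hp : 0 < p) (hpq : p ≤ q) (hq : q < 1) (hG : ∅ ∉ cuts G)
    (hqγ : q ^ gammaParam G Y w k = 1 / 2)
    (hpl : 4 * (V(G).ncard : ℝ) ^ (-3 : ℝ) ≤ p ^ minCut G) (hθ : p < theta G) :
    relSecondMoment G q (fun S => zCut (contract G S) (p / q)) ≤
      2 + 18 / Real.logb 2 (V(G).ncard : ℝ) := by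
  have hq0 : 0 < q := hp.trans_le hpq
  have hp1 : p < 1 := hpq.trans_lt hq
  have hz := pow_minCut_le_zCut (cuts_nonempty hn) hp.le
  have hz0 : 0 < zCut G p := lt_of_lt_of_le (by positivity) hz
  have hlogp := Real.log_neg hp hp1
  have hlogq := Real.log_neg hq0 hq
  set L := Real.logb 2 (V(G).ncard : ℝ)
  set a := Real.log q / Real.log p with ha
  have ha0 : 0 < a := div_pos_of_neg_of_neg hlogq hlogp
  have ha1 : a ≤ 1 := (div_le_one_of_neg hlogp).2 (Real.log_le_log hp hpq)
  have hqa : p ^ a = q := by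
    rw [Real.rpow_def_of_pos hp, ha, mul_div_cancel₀ _ hlogp.ne, Real.exp_log hq0]
  have hL0 : 0 < L := by linarith
  have hsum := (mul_rpow_le_sum_pow Y w hk (gammaParam_bounds h hk hkn).2.2 hp).trans
    (h.sum_le_zCut hG hp.le)
  rw [← hqa] at hqγ
  have hinv := inv_rpow_le hp hp1 ha0 ha1 (by positivity) hk hkn' hqγ hz hsum hpl
  have hx : (zCut G p + xCut G p) / zCut G p ^ 2 ≤ (1 + 1 / L) * (zCut G p)⁻¹ := by
    have h1 := xCut_div_zCut_le G hp hθ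
    have h2 : (zCut G p + xCut G p) / zCut G p ^ 2
        = (1 + xCut G p / zCut G p) * (zCut G p)⁻¹ := by
      field_simp
    rw [h2]
    gcongr
  have hx0 : 0 ≤ xCut G p := Finset.sum_nonneg fun _ _ => by positivity
  rw [relSecondMoment_eq G hq0.ne', ← hqa]
  calc _ ≤ ((zCut G p + xCut G p) / zCut G p ^ 2) ^ a :=
        second_moment_le_of_rpow G hp ha0 ha1 hz0
    _ ≤ ((1 + 1 / L) * (zCut G p)⁻¹) ^ a := by gcongr
    _ = (1 + 1 / L) ^ a * (zCut G p)⁻¹ ^ a := Real.mul_rpow (by positivity) (by positivity)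
    _ ≤ (1 + 1 / L) ^ (1 : ℝ) * (2 * (1 + 1 / k)) := by
        gcongr
        exact le_add_of_nonneg_right (by positivity)
    _ ≤ (1 + 1 / L) * (2 * (1 + 4 / L)) := by
        rw [Real.rpow_one]
        gcongr
    _ ≤ 2 + 18 / L := by
        have h1 : 1 / L ≤ 1 := (div_le_one hL0).2 hL
        have h2 : 0 ≤ 1 / L := by positivity
        have h4 : 4 / L = 4 * (1 / L) := by ring
        have h18 : 18 / L = 18 * (1 / L) := by ring
        rw [h4, h18]
        -- With `y = 1/L ≤ 1`: `2(1+y)(1+4y) = 2 + 10y + 8y² ≤ 2 + 18y`.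
        nlinarith

theorem relSecondMoment_le_of_small [Fintype α] {G : Graph α β} (hn : 2 ≤ V(G).ncard)
    (hn' : V(G).ncard ≤ 16) {p q γ : ℝ} (hp : 0 < p) (hp1 : p ≤ 1) (hq : 0 < q) (hq1 : q ≤ 1)
    (hqγ : q ^ γ = 1 / 2) (hγ : 3 / 4 * (minCut G : ℝ) ≤ γ)
    (hpl : p ^ minCut G ≤ (V(G).ncard : ℝ) ^ (-(1 / 2) : ℝ)) :
    relSecondMoment G q (fun S => zCut (contract G S) (p / q)) ≤ 2 ^ 34 := by
  have hql : 1 / 16 ≤ (q ^ minCut G) ^ 3 := by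
    calc (1 / 16 : ℝ) = (q ^ γ) ^ (4 : ℕ) := by rw [hqγ]; norm_num
      _ = q ^ (γ * 4) := by
          rw [← Real.rpow_natCast, ← Real.rpow_mul hq.le]
          norm_num
      _ ≤ q ^ ((minCut G : ℝ) * 3) :=
          Real.rpow_le_rpow_of_exponent_ge hq hq1 (by linarith)
      _ = (q ^ minCut G) ^ 3 := by
          rw [Real.rpow_mul hq.le, Real.rpow_natCast]
          exact_mod_cast rfl
  have hql0 : 0 < q ^ minCut G := by positivity
  have hq4 : 1 / 4 ≤ q ^ minCut G := by
    by_contra! hlt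
    have := pow_lt_pow_left₀ hlt hql0.le (n := 3) (by norm_num)
    norm_num at this
    linarith
  have hcase : p ^ 2 ≤ q ∨ ∀ C ∈ cuts G, C.card ≤ minCut G := by
    -- For `n ≥ 3`, `q < p²` would give `q^λ ≤ p^(2λ) ≤ 1/3`, contradicting `(q^λ)³ ≥ 1/16`. For `n
    -- = 2` this fails to contradict, but there is only one cut.
    rcases hn.eq_or_lt with h2 | h3
    · right
      intro C hC
      obtain ⟨D, hD, hcard⟩ := exists_card_eq_minCut (cuts_nonempty hn)
      rw [← hcard, eq_of_mem_cuts_of_ncard_eq_two h2.symm hC hD]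
    · left
      by_contra! hlt
      have hp2 : (p ^ minCut G) ^ 2 ≤ 1 / 3 := by
        calc (p ^ minCut G) ^ 2 ≤ ((V(G).ncard : ℝ) ^ (-(1 / 2) : ℝ)) ^ 2 := by gcongr
          _ = (V(G).ncard : ℝ)⁻¹ := by
              rw [← Real.rpow_natCast, ← Real.rpow_mul (by positivity), ← Real.rpow_neg_one]
              norm_num
          _ ≤ 1 / 3 := by
              rw [one_div]
              gcongr
              exact_mod_cast h3
      have hle : q ^ minCut G ≤ 1 / 3 := by
        calc q ^ minCut G ≤ (p ^ 2) ^ minCut G := by gcongr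
          _ ≤ 1 / 3 := by rwa [pow_right_comm]
      have := pow_le_pow_left₀ hql0.le hle 3
      norm_num at this
      linarith
  rw [relSecondMoment_eq G hq.ne']
  refine (second_moment_le_of_card G hp hp1 hq hq1 (cuts_nonempty hn) hcase).trans ?_
  have hcuts : ((cuts G).card : ℝ) ≤ 2 ^ 16 := by
    exact_mod_cast (card_cuts_le G).trans (Nat.pow_le_pow_right (by norm_num) hn')
  calc ((cuts G).card : ℝ) ^ 2 * (q ^ minCut G)⁻¹ ≤ (2 ^ 16) ^ 2 * (1 / 4)⁻¹ := by gcongr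
    _ = 2 ^ 34 := by norm_num

/-- If `q < p`, then `1/16 = (q^γ)^4 < (p^γ)^4 ≤ (p^l)^3 ≤ 1/64`. -/
theorem le_of_sixteen_le {p q γ : ℝ} {n l : ℕ} (hn : 16 ≤ n) (hp : 0 < p) (hp1 : p ≤ 1)
    (hq : 0 < q) (hqγ : q ^ γ = 1 / 2) (hγ : 3 / 4 * (l : ℝ) ≤ γ) (hγ0 : 0 < γ)
    (hpl : p ^ l ≤ (n : ℝ) ^ (-(1 / 2) : ℝ)) : p ≤ q := by
  by_contra! hlt
  have h1 : (q ^ γ) ^ 4 < (p ^ γ) ^ 4 := by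
    gcongr
  have h2 : (p ^ γ) ^ 4 ≤ (p ^ l) ^ 3 := by
    rw [← Real.rpow_natCast (p ^ γ), ← Real.rpow_mul hp.le, ← pow_mul, ← Real.rpow_natCast p]
    refine Real.rpow_le_rpow_of_exponent_ge hp hp1 ?_
    push_cast
    linarith
  have h3 : p ^ l ≤ 1 / 4 := by
    refine hpl.trans ?_
    calc (n : ℝ) ^ (-(1 / 2) : ℝ) ≤ (16 : ℝ) ^ (-(1 / 2) : ℝ) :=
          Real.rpow_le_rpow_of_nonpos (by norm_num) (by exact_mod_cast hn) (by norm_num)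
      _ = 1 / 4 := by
          rw [show (16 : ℝ) = 4 ^ (2 : ℝ) by norm_num, ← Real.rpow_mul (by norm_num)]
          norm_num [Real.rpow_neg_one]
  have h4 : (p ^ l) ^ 3 ≤ (1 / 4) ^ 3 := by gcongr
  rw [hqγ] at h1
  norm_num at h1 h4
  linarith

end

end Unreliability


theorem mainTheorem7 :
    ∃ K : ℝ, ∀ (α : Type*) (β : Type*) [Fintype α] [Fintype β] (G : Graph α β)
      (n : ℕ) (_ : V(G).ncard = n) (_ : 2 ≤ n)
      (Y : SimpleGraph V(G)) (w : Sym2 V(G) → ℕ) (_ : Unreliability.IsGomoryHuTree G Y w)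
      (k : ℕ) (_ : |(k : ℝ) - (2 : ℝ) ^ (-(2 / 3) : ℝ) * (n : ℝ)| < 1) (_ : k < n)
      (p q : ℝ) (_ : 0 ≤ p) (_ : 0 < q)
      (_ : q ^ Unreliability.gammaParam G Y w k = 1 / 2)
      (_ : 4 * (n : ℝ) ^ (-3 : ℝ) ≤ p ^ Unreliability.minCut G)
      (_ : p ^ Unreliability.minCut G ≤ (n : ℝ) ^ (-(1 / 2) : ℝ))
      (_ : p < Unreliability.theta G),
      0 < Unreliability.expect G q
          (fun S => Unreliability.zCut (Unreliability.contract G S) (p / q)) ∧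
        Unreliability.relSecondMoment G q
          (fun S => Unreliability.zCut (Unreliability.contract G S) (p / q)) ≤
          2 + K / Real.logb 2 (n : ℝ) := by
  open Unreliability in
  -- For `n ≤ 16`, `log n ≤ 4` turns the bound `2^34` into `2^36 / log n`; the other range needs
  -- only 18.
  refine ⟨2 ^ 36, ?_⟩
  intro α β _ _ G n hGn hn Y w hY k hk hkn p q hp hq hqγ hpl hpu hθ
  subst hGn
  set n := V(G).ncard
  have hn2 : (2 : ℝ) ≤ n := by exact_mod_cast hn
  have hn0 : (0 : ℝ) < n := by linarith
  have hu1 : (n : ℝ) ^ (-(1 / 2) : ℝ) < 1 :=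
    Real.rpow_lt_one_of_one_lt_of_neg (by linarith) (by norm_num)
  have hpl0 : 0 < p ^ minCut G := lt_of_lt_of_le (by positivity) hpl
  have hl : minCut G ≠ 0 := by
    intro h0
    rw [h0, pow_zero] at hpu
    linarith
  have hp0 : 0 < p := hp.lt_of_ne' fun h0 => by
    rw [h0, zero_pow hl] at hpl0
    exact hpl0.false
  have hp1 : p < 1 := by
    by_contra! h1
    have := one_le_pow₀ h1 (n := minCut G)
    linarith
  have hG : ∅ ∉ cuts G := fun h0 => hl (Nat.le_zero.1 (minCut_le_card h0))
  have hhalf : (1 / 2 : ℝ) ≤ (2 : ℝ) ^ (-(2 / 3) : ℝ) := by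
    rw [one_div, ← Real.rpow_neg_one]
    exact Real.rpow_le_rpow_of_exponent_le (by norm_num) (by norm_num)
  have hhalf' : 1 / 2 * (n : ℝ) ≤ (2 : ℝ) ^ (-(2 / 3) : ℝ) * n := by gcongr
  rw [abs_lt] at hk
  have hk0 : k ≠ 0 := by
    rintro rfl
    have := hk.1
    push_cast at this
    linarith
  have hk1 : (1 : ℝ) ≤ k := by exact_mod_cast Nat.one_le_iff_ne_zero.2 hk0
  obtain ⟨hγ, hγ', -⟩ := gammaParam_bounds hY hk0 hkn
  have hγ0 : 0 < gammaParam G Y w k := by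
    have : (0 : ℝ) < minCut G := Nat.cast_pos.2 (Nat.pos_of_ne_zero hl)
    linarith
  have hq1 : q < 1 := by
    by_contra! h1
    have := Real.one_le_rpow h1 hγ0.le
    linarith
  have hL : 1 ≤ Real.logb 2 (n : ℝ) := by
    rw [Real.le_logb_iff_rpow_le (by norm_num) hn0, Real.rpow_one]
    exact hn2
  refine ⟨?_, ?_⟩
  · rw [expect_zCut_contract G hq.ne']
    exact hpl0.trans_le (pow_minCut_le_zCut (cuts_nonempty hn) hp)
  · rcases le_total n 16 with h16 | h16
    · refine (relSecondMoment_le_of_small hn h16 hp0 hp1.le hq hq1.le hqγ hγ hpu).trans ?_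
      have hL4 : Real.logb 2 (n : ℝ) ≤ 4 := by
        rw [Real.logb_le_iff_le_rpow (by norm_num) hn0]
        norm_num
        exact_mod_cast h16
      have : (2 : ℝ) ^ 34 ≤ 2 ^ 36 / Real.logb 2 (n : ℝ) := by
        rw [le_div_iff₀ (by linarith)]
        linarith
      linarith
    · have hpq := le_of_sixteen_le h16 hp0 hp1.le hq hqγ hγ hγ0 hpu
      -- From `k + 1 > n/2` and `k ≥ 1`: `4k ≥ 2(k + 1) > n ≥ log n`.
      have hkL : 1 / (k : ℝ) ≤ 4 / Real.logb 2 (n : ℝ) := by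
        have := logb_two_le_self (n := n)
        rw [div_le_div_iff₀ (by linarith) (by linarith)]
        linarith
      refine (relSecondMoment_le_of_large hn hY hk0 hkn (by linarith) hkL hL hp0 hpq hq1 hG hqγ
        hpl hθ).trans ?_
      gcongr
      norm_num
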